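/- Let $n\ge 1$ and $d_1,\dots,d_n\ge 1$ be integers, and let $D=\max_i d_i$. Let $\mathcal H_{(d)}$ be the space of systems $g=(g_1,\dots,g_n)$, where $g_i\in\mathbb C[X_0,\dots,X_n]$ is homogeneous of degree $d_i$, with the (unitarily invariant) Bombieri--Weyl norm $$\|g\|^2=\sum_{i=1}^n\ \sum_{|\alpha|=d_i}\frac{\alpha!}{d_i!}\,|a_{i,\alpha}|^2,\qquad g_i=\sum_{|\alpha|=d_i}a_{i,\alpha}X^\alpha .$$ For $g\in\mathcal H_{(d)}\setminus\{0\}$ and $x\in\mathbb C^{n+1}\setminus\{0\}$ let $N_x$ be the Hermitian complement of $x$ and $$\mu_{\rm norm}(g,x)=\|g\|\,\Bigl\|\bigl(Dg(x)|_{N_x}\bigr)^{-1}\,\mathrm{diag}\bigl(d_i^{1/2}\|x\|^{d_i-1}\bigr)\Bigr\|\in(0,\infty],$$ with the standard Hermitian norm on $\mathbb C^{n+1}$ and the operator norm, and with $\mu_{\rm norm}(g,x)=\infty$ if $Dg(x)|_{N_x}$ is not invertible. This depends only on the classes of $g$ in $\mathbb P(\mathcal H_{(d)})$ and of $x$ in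 $\mathbb P(\mathbb C^{n+1})$. Let $d(\zeta,\eta)=\arccos\frac{|\langle \zeta,\eta\rangle|}{\|\zeta\|\,\|\eta\|}$ be the Riemannian distance (the angle) on $\mathbb P(\mathbb C^{n+1})$. **Theorem 1.** For every $\epsilon>0$ there is a constant $C>0$, depending only on $\epsilon$ (and not on $n$, $d_1,\dots,d_n$, $g$, $\zeta$ or $\eta$), such that for all $n\ge1$, all $d_1,\dots,d_n\ge1$, all $g\in\mathbb P(\mathcal H_{(d)})$ and all $\zeta,\eta\in\mathbb P(\mathbb C^{n+1})$: if $$d(\zeta,\eta)<\frac{C}{D^{3/2}\,\mu_{\rm norm}(g,\zeta)}$$ (the right-hand side being $0$ when $\mu_{\rm norm}(g,\zeta)=\infty$), then $$\mu_{\rm norm}(g,\eta)\le(1+\epsilon)\,\mu_{\rm norm}(g,\zeta).$$ -/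

import Mathlib

open scoped ENNReal LinearAlgebra.Projectivization

noncomputable section

namespace CondNumber

/-- The space of systems `g = (g_1, …, g_n)` of homogeneous polynomials in `X_0, …, X_n` over `ℂ`,
with `g_i` homogeneous of degree `d_i`. -/
abbrev PolySystem (n : ℕ) (d : Fin n → ℕ) : Type :=
  (i : Fin n) → MvPolynomial.homogeneousSubmodule (Fin (n + 1)) ℂ (d i)

/-- The maximum `D` of the degrees. -/
def maxDegree {n : ℕ} (d : Fin n → ℕ) : ℕ := Finset.univ.sup d

/-- The Bombieri–Weyl (Kostlan) norm of a homogeneous system: the squared norm of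
`∑ a_α X^α` of degree `l` is `∑ |a_α|² / (l! / α!)`, and squared norms of components add up. -/
def weylNorm {n : ℕ} {d : Fin n → ℕ} (g : PolySystem n d) : ℝ :=
  √(∑ i, ∑ α ∈ (g i : MvPolynomial (Fin (n + 1)) ℂ).support,
    ‖(g i : MvPolynomial (Fin (n + 1)) ℂ).coeff α‖ ^ 2 / (Finsupp.multinomial α : ℝ))

/-- The Jacobian matrix of `g : ℂ^(n+1) → ℂ^n` at `x`. -/
def jacobian {n : ℕ} {d : Fin n → ℕ} (g : PolySystem n d)
    (x : EuclideanSpace ℂ (Fin (n + 1))) : Matrix (Fin n) (Fin (n + 1)) ℂ :=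
  Matrix.of fun i j =>
    MvPolynomial.eval x (MvPolynomial.pderiv j (g i : MvPolynomial (Fin (n + 1)) ℂ))

/-- The derivative `Dg(x) : ℂ^(n+1) → ℂ^n`. -/
def differential {n : ℕ} {d : Fin n → ℕ} (g : PolySystem n d) (x : EuclideanSpace ℂ (Fin (n + 1))) :
    EuclideanSpace ℂ (Fin (n + 1)) →L[ℂ] EuclideanSpace ℂ (Fin n) :=
  (Matrix.toLpLin 2 2 (jacobian g x)).toContinuousLinearMap

/-- The diagonal operator `Δ(a_1, …, a_n)` on `ℂ^n`. -/
def diagOp {n : ℕ} (a : Fin n → ℂ) : EuclideanSpace ℂ (Fin n) →L[ℂ] EuclideanSpace ℂ (Fin n) :=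
  (Matrix.toLpLin 2 2 (Matrix.diagonal a)).toContinuousLinearMap

open Classical in
/-- `‖g‖ ‖(Dg(x)|_N)⁻¹ Δ(d_i^{1/2} ‖x‖^{d_i-1})‖`, with value `∞` if `Dg(x)|_N` is
not invertible. -/
def muOn {n : ℕ} {d : Fin n → ℕ} (g : PolySystem n d) (x : EuclideanSpace ℂ (Fin (n + 1)))
    (N : Submodule ℂ (EuclideanSpace ℂ (Fin (n + 1)))) : ℝ≥0∞ :=
  if ((differential g x).comp N.subtypeL).IsInvertible then
    ENNReal.ofReal (weylNorm g *
      ‖((differential g x).comp N.subtypeL).inverse.comp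
        (diagOp fun i => ((√(d i : ℝ) * ‖x‖ ^ (d i - 1) : ℝ) : ℂ))‖)
  else ∞

/-- The normalized condition number on representatives, with `N` the Hermitian complement
of `x`. -/
def mu {n : ℕ} {d : Fin n → ℕ} (g : PolySystem n d) (x : EuclideanSpace ℂ (Fin (n + 1))) : ℝ≥0∞ :=
  muOn g x (ℂ ∙ x)ᗮ

lemma diagOp_apply {n : ℕ} (a : Fin n → ℂ) (v : EuclideanSpace ℂ (Fin n)) (i : Fin n) :
    diagOp a v i = a i * v i := by
  simp [diagOp, Matrix.mulVec_diagonal]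

lemma diagOp_comp {n : ℕ} (a b : Fin n → ℂ) :
    (diagOp a).comp (diagOp b) = diagOp (fun i => a i * b i) := by
  ext v i
  simp [diagOp_apply, mul_assoc]

lemma diagOp_one {n : ℕ} : diagOp (fun _ : Fin n => (1 : ℂ)) = ContinuousLinearMap.id ℂ _ := by
  ext v i
  simp [diagOp_apply]

lemma norm_diagOp_le {n : ℕ} (a : Fin n → ℂ) (c : ℝ) (hc : 0 ≤ c) (h : ∀ i, ‖a i‖ ≤ c) :
    ‖diagOp a‖ ≤ c := by
  refine ContinuousLinearMap.opNorm_le_bound _ hc fun v => ?_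
  rw [EuclideanSpace.norm_eq, EuclideanSpace.norm_eq]
  refine Real.sqrt_le_iff.2 ⟨by positivity, ?_⟩
  rw [mul_pow, Real.sq_sqrt (by positivity), Finset.mul_sum]
  refine Finset.sum_le_sum fun i _ => ?_
  rw [diagOp_apply, norm_mul, mul_pow]
  gcongr
  exact h i

lemma weylNorm_smul {n : ℕ} {d : Fin n → ℕ} (a : ℂ) (ha : a ≠ 0) (g : PolySystem n d) :
    weylNorm (a • g) = ‖a‖ * weylNorm g := by
  unfold weylNorm
  rw [← Real.sqrt_sq (norm_nonneg a), ← Real.sqrt_mul (by positivity), Finset.mul_sum]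
  congr 1
  refine Finset.sum_congr rfl fun i _ => ?_
  rw [Finset.mul_sum]
  have : ((a • g) i : MvPolynomial (Fin (n + 1)) ℂ) = a • (g i : MvPolynomial (Fin (n + 1)) ℂ) :=
    rfl
  rw [this, MvPolynomial.support_smul_eq ha]
  refine Finset.sum_congr rfl fun α _ => ?_
  rw [MvPolynomial.coeff_smul, smul_eq_mul, norm_mul]
  ring

lemma eval_smul_of_isHomogeneous {n l : ℕ} {p : MvPolynomial (Fin (n + 1)) ℂ}
    (hp : p.IsHomogeneous l) (b : ℂ) (x : EuclideanSpace ℂ (Fin (n + 1))) :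
    MvPolynomial.eval (b • x) p = b ^ l * MvPolynomial.eval x p := by
  rw [MvPolynomial.eval_eq, MvPolynomial.eval_eq, Finset.mul_sum]
  refine Finset.sum_congr rfl fun α hα => ?_
  have hα' : ∑ i ∈ α.support, α i = l := by
    have := hp (MvPolynomial.mem_support_iff.1 hα)
    simpa [Finsupp.weight_apply, Finsupp.sum] using this
  simp only [PiLp.smul_apply, smul_eq_mul, mul_pow, Finset.prod_mul_distrib,
    Finset.prod_pow_eq_pow_sum, hα']
  ring

lemma differential_smul {n : ℕ} {d : Fin n → ℕ} (a b : ℂ) (g : PolySystem n d)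
    (x : EuclideanSpace ℂ (Fin (n + 1))) :
    differential (a • g) (b • x) = (diagOp fun i => a * b ^ (d i - 1)).comp (differential g x) := by
  have h : jacobian (a • g) (b • x) =
      Matrix.diagonal (fun i => a * b ^ (d i - 1)) * jacobian g x := by
    ext i j
    rw [Matrix.diagonal_mul]
    have hp := ((MvPolynomial.mem_homogeneousSubmodule _ _).1 (g i).2).pderiv (i := j)
    have : ((a • g) i : MvPolynomial (Fin (n + 1)) ℂ)
        = a • (g i : MvPolynomial (Fin (n + 1)) ℂ) := rfl
    simp only [jacobian, Matrix.of_apply, this]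
    rw [Derivation.map_smul, MvPolynomial.smul_eval, eval_smul_of_isHomogeneous hp, mul_assoc]
  ext v i
  simp [differential, diagOp, h]

lemma mu_smul_le {n : ℕ} {d : Fin n → ℕ} (a b : ℂ) (ha : a ≠ 0) (hb : b ≠ 0)
    (g : PolySystem n d) (x : EuclideanSpace ℂ (Fin (n + 1))) :
    mu (a • g) (b • x) ≤ mu g x := by
  have hs : (ℂ ∙ (b • x)) = (ℂ ∙ x) := Submodule.span_singleton_smul_eq (IsUnit.mk0 b hb) x
  unfold mu
  rw [hs]
  generalize (ℂ ∙ x)ᗮ = N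
  unfold muOn
  rw [differential_smul, ContinuousLinearMap.comp_assoc]
  generalize (differential g x).comp N.subtypeL = A
  have hne : ∀ i, a * b ^ (d i - 1) ≠ 0 := fun i => mul_ne_zero ha (pow_ne_zero _ hb)
  have h1 : (diagOp fun i => a * b ^ (d i - 1)).comp (diagOp fun i => (a * b ^ (d i - 1))⁻¹)
      = ContinuousLinearMap.id ℂ _ := by
    rw [diagOp_comp, ← diagOp_one]
    congr 1
    exact funext fun i => mul_inv_cancel₀ (hne i)
  have h2 : (diagOp fun i => (a * b ^ (d i - 1))⁻¹).comp (diagOp fun i => a * b ^ (d i - 1))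
      = ContinuousLinearMap.id ℂ _ := by
    rw [diagOp_comp, ← diagOp_one]
    congr 1
    exact funext fun i => inv_mul_cancel₀ (hne i)
  have hE := ContinuousLinearMap.IsInvertible.of_inverse h1 h2
  by_cases hA : A.IsInvertible
  · rw [if_pos hA, if_pos (hE.comp hA), hE.inverse_comp_of_left,
      ContinuousLinearMap.inverse_eq h1 h2, weylNorm_smul a ha, ContinuousLinearMap.comp_assoc,
      diagOp_comp]
    refine ENNReal.ofReal_le_ofReal ?_
    have hfac : (diagOp fun i => (a * b ^ (d i - 1))⁻¹ *
          ((√(d i : ℝ) * ‖b • x‖ ^ (d i - 1) : ℝ) : ℂ))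
        = (diagOp fun i => ((√(d i : ℝ) * ‖x‖ ^ (d i - 1) : ℝ) : ℂ)).comp
          (diagOp fun i => (a * b ^ (d i - 1))⁻¹ * ((‖b‖ ^ (d i - 1) : ℝ) : ℂ)) := by
      rw [diagOp_comp]
      congr 1
      funext i
      rw [norm_smul, mul_pow]
      push_cast
      ring
    have hle : ‖diagOp fun i => (a * b ^ (d i - 1))⁻¹ * ((‖b‖ ^ (d i - 1) : ℝ) : ℂ)‖ ≤ ‖a‖⁻¹ := by
      refine norm_diagOp_le _ _ (by positivity) fun i => le_of_eq ?_
      have hb' : ‖b‖ ≠ 0 := norm_ne_zero_iff.2 hb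
      have ha' : ‖a‖ ≠ 0 := norm_ne_zero_iff.2 ha
      simp
      field_simp
    rw [hfac, ← ContinuousLinearMap.comp_assoc]
    have hw : 0 ≤ weylNorm g := Real.sqrt_nonneg _
    have ha' : ‖a‖ ≠ 0 := norm_ne_zero_iff.2 ha
    refine (mul_le_mul_of_nonneg_left ((ContinuousLinearMap.opNorm_comp_le _ _).trans
      (mul_le_mul_of_nonneg_left hle (norm_nonneg _))) (by positivity)).trans (le_of_eq ?_)
    field_simp
  · rw [if_neg hA]
    exact le_top

lemma mu_smul {n : ℕ} {d : Fin n → ℕ} (a b : ℂ) (ha : a ≠ 0) (hb : b ≠ 0)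
    (g : PolySystem n d) (x : EuclideanSpace ℂ (Fin (n + 1))) :
    mu (a • g) (b • x) = mu g x := by
  refine le_antisymm (mu_smul_le a b ha hb g x) ?_
  have := mu_smul_le a⁻¹ b⁻¹ (inv_ne_zero ha) (inv_ne_zero hb) (a • g) (b • x)
  rwa [inv_smul_smul₀ ha, inv_smul_smul₀ hb] at this

/-- The normalized condition number `μ_norm` on `ℙ(H_(d)) × ℙ(ℂ^(n+1))`. -/
def muNorm {n : ℕ} {d : Fin n → ℕ} (g : ℙ ℂ (PolySystem n d))
    (ζ : ℙ ℂ (EuclideanSpace ℂ (Fin (n + 1)))) : ℝ≥0∞ :=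
  Projectivization.lift
    (fun f => Projectivization.lift (fun x => mu f.1 x.1)
      (fun x y t h => by
        have ht : t ≠ 0 := fun h0 => x.2 (by rw [h, h0, zero_smul])
        have := mu_smul 1 t one_ne_zero ht f.1 y.1
        rwa [one_smul, ← h] at this) ζ)
    (fun f g t h => by
      have ht : t ≠ 0 := fun h0 => f.2 (by rw [h, h0, zero_smul])
      induction ζ using Projectivization.ind with
      | h x hx =>
        have := mu_smul t 1 ht one_ne_zero g.1 x
        rwa [one_smul, ← h] at this) g

/-- The angle between the complex lines spanned by `x` and `y`. -/
def lineAngle {n : ℕ} (x y : EuclideanSpace ℂ (Fin (n + 1))) : ℝ :=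
  Real.arccos (‖inner ℂ x y‖ / (‖x‖ * ‖y‖))

lemma lineAngle_smul {n : ℕ} (a b : ℂ) (ha : a ≠ 0) (hb : b ≠ 0)
    (x y : EuclideanSpace ℂ (Fin (n + 1))) :
    lineAngle (a • x) (b • y) = lineAngle x y := by
  have ha' : ‖a‖ ≠ 0 := norm_ne_zero_iff.2 ha
  have hb' : ‖b‖ ≠ 0 := norm_ne_zero_iff.2 hb
  unfold lineAngle
  congr 1
  rw [inner_smul_left, inner_smul_right, norm_mul, norm_mul, norm_smul, norm_smul,
    RCLike.norm_conj, show ‖a‖ * (‖b‖ * ‖inner ℂ x y‖) = (‖a‖ * ‖b‖) * ‖inner ℂ x y‖ by ring,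
    show ‖a‖ * ‖x‖ * (‖b‖ * ‖y‖) = (‖a‖ * ‖b‖) * (‖x‖ * ‖y‖) by ring,
    mul_div_mul_left _ _ (mul_ne_zero ha' hb')]

/-- The Riemannian (Fubini–Study) distance on `ℙ(ℂ^(n+1))`, i.e. the angle. -/
def angleDist {n : ℕ} (ζ η : ℙ ℂ (EuclideanSpace ℂ (Fin (n + 1)))) : ℝ :=
  Projectivization.lift
    (fun x => Projectivization.lift (fun y => lineAngle x.1 y.1)
      (fun y z t h => by
        have ht : t ≠ 0 := fun h0 => y.2 (by rw [h, h0, zero_smul])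
        have := lineAngle_smul 1 t one_ne_zero ht x.1 z.1
        rwa [one_smul, ← h] at this) η)
    (fun x z t h => by
      have ht : t ≠ 0 := fun h0 => x.2 (by rw [h, h0, zero_smul])
      induction η using Projectivization.ind with
      | h y hy =>
        have := lineAngle_smul t 1 ht one_ne_zero z.1 y
        rwa [one_smul, ← h] at this) ζ

end CondNumber

end

open MvPolynomial in
/-- The directional derivative of a polynomial along `v`, as a polynomial. -/
noncomputable def MvPolynomial.dirDeriv {σ : Type*} [Fintype σ] (p : MvPolynomial σ ℂ)
    (v : σ → ℂ) : MvPolynomial σ ℂ :=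
  ∑ j, C (v j) * pderiv j p

namespace CondNumber

open MvPolynomial Finset

/-- The Bombieri–Weyl norm of a single polynomial. -/
noncomputable def polyNorm {σ : Type*} (p : MvPolynomial σ ℂ) : ℝ :=
  √(∑ α ∈ p.support, ‖p.coeff α‖ ^ 2 / (Finsupp.multinomial α : ℝ))

lemma polyNorm_nonneg {σ : Type*} (p : MvPolynomial σ ℂ) : 0 ≤ polyNorm p := Real.sqrt_nonneg _

lemma multinomial_pos {σ : Type*} (α : σ →₀ ℕ) : 0 < Finsupp.multinomial α := by
  rw [Finsupp.multinomial_eq]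
  exact Nat.multinomial_pos _ _

section Polynomial

variable {σ : Type*} [Fintype σ]

lemma hasDerivAt_eval_line (p : MvPolynomial σ ℂ) (x v : σ → ℂ) (t : ℂ) :
    HasDerivAt (fun t : ℂ => eval (x + t • v) p) (eval (x + t • v) (p.dirDeriv v)) t := by
  induction p using MvPolynomial.induction_on with
  | C a => simpa [dirDeriv] using hasDerivAt_const t a
  | add p q hp hq =>
    have : (p + q).dirDeriv v = p.dirDeriv v + q.dirDeriv v := by
      simp [dirDeriv, mul_add, sum_add_distrib]
    rw [this]
    simpa using! hp.add hq
  | mul_X p i hp =>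
    classical
    have h : (p * X i).dirDeriv v = p.dirDeriv v * X i + p * C (v i) := by
      simp only [dirDeriv, Derivation.leibniz, smul_eq_mul, pderiv_X, mul_add, sum_add_distrib,
        sum_mul]
      rw [add_comm]
      congr 1
      · exact sum_congr rfl fun j _ => by ring
      · rw [sum_eq_single i]
        · simp [mul_comm]
        · intro j _ hj
          simp [hj.symm]
        · simp
    have hX : HasDerivAt (fun t : ℂ => x i + t * v i) (v i) t := by
      simpa using ((hasDerivAt_id t).mul_const (v i)).const_add (x i)
    rw [h]
    simpa using! hp.mul hX

/-- **Cauchy's estimate** for the directional derivatives of a polynomial. -/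
lemma norm_eval_dirDeriv_le (p : MvPolynomial σ ℂ) {R r M : ℝ} (hr : 0 < r)
    (hM : ∀ z : EuclideanSpace ℂ σ, ‖z‖ ≤ R + r → ‖eval z p‖ ≤ M)
    {x : EuclideanSpace ℂ σ} (hx : ‖x‖ ≤ R) (v : EuclideanSpace ℂ σ) :
    ‖eval x (p.dirDeriv v)‖ ≤ M / r * ‖v‖ := by
  rcases eq_or_ne v 0 with rfl | hv
  · simp [dirDeriv]
  have hv' : 0 < ‖v‖ := norm_pos_iff.2 hv
  have hd := hasDerivAt_eval_line p x v
  have key := Complex.norm_deriv_le_of_forall_mem_sphere_norm_le (c := 0) (R := r / ‖v‖) (C := M)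
    (f := fun t : ℂ => eval (x.ofLp + t • v.ofLp) p) (by positivity)
    (Differentiable.diffContOnCl fun t => (hd t).differentiableAt) (fun z hz => by
      refine hM (x + z • v) ((norm_add_le _ _).trans ?_)
      rw [mem_sphere_zero_iff_norm] at hz
      rw [norm_smul, hz, div_mul_cancel₀ _ hv'.ne']
      gcongr)
  rw [(hd 0).deriv] at key
  simp only [zero_smul, add_zero] at key
  refine key.trans (le_of_eq ?_)
  field_simp

/-- A polynomial whose directional derivatives are bounded by `M` on the unit ball is
`M`-Lipschitz there. -/
lemma norm_eval_sub_eval_le (p : MvPolynomial σ ℂ) {M : ℝ}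
    (hM : ∀ z : EuclideanSpace ℂ σ, ‖z‖ ≤ 1 → ∀ u : EuclideanSpace ℂ σ,
      ‖eval z (p.dirDeriv u)‖ ≤ M * ‖u‖)
    {x y : EuclideanSpace ℂ σ} (hx : ‖x‖ ≤ 1) (hy : ‖y‖ ≤ 1) :
    ‖eval y p - eval x p‖ ≤ M * ‖y - x‖ := by
  have hd := hasDerivAt_eval_line p x (y - x)
  have key := norm_image_sub_le_of_norm_deriv_le_segment_01' (C := M * ‖y - x‖)
    (f := fun t : ℝ => eval (x.ofLp + (t : ℂ) • (y - x).ofLp) p)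
    (f' := fun t : ℝ => eval (x.ofLp + (t : ℂ) • (y - x).ofLp) (p.dirDeriv (y - x)))
    (fun t _ => (hd t).comp_ofReal.hasDerivWithinAt) (fun t ht => by
      refine hM (x + (t : ℂ) • (y - x)) ?_ _
      have : x + (t : ℂ) • (y - x) = ((1 - t : ℝ) : ℂ) • x + (t : ℂ) • y := by
        push_cast
        module
      rw [this]
      refine (norm_add_le _ _).trans ?_
      rw [norm_smul, norm_smul, Complex.norm_of_nonneg ht.1,
        Complex.norm_of_nonneg (sub_nonneg.2 ht.2.le)]
      nlinarith [ht.1, ht.2])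
  simpa using key

lemma sum_multinomial_mul_le {p : MvPolynomial σ ℂ} {l : ℕ} (hp : p.IsHomogeneous l)
    (x : EuclideanSpace ℂ σ) :
    ∑ α ∈ p.support, (Finsupp.multinomial α : ℝ) * ∏ i, (‖x i‖ ^ 2) ^ α i ≤ (‖x‖ ^ l) ^ 2 := by
  classical
  rw [← pow_mul, mul_comm l 2, pow_mul, EuclideanSpace.norm_sq_eq, sum_pow_eq_sum_piAntidiag]
  refine le_of_eq_of_le ?_ (sum_le_sum_of_subset_of_nonneg
    (s := p.support.map ⟨fun α : σ →₀ ℕ => (α : σ → ℕ), DFunLike.coe_injective⟩)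
    (fun f hf => ?_) (fun f _ _ => by positivity))
  · rw [sum_map]
    refine sum_congr rfl fun α _ => ?_
    rw [← Finsupp.multinomial_of_support_subset (subset_univ _)]
    rfl
  · obtain ⟨α, hα, rfl⟩ := mem_map.1 hf
    rw [mem_piAntidiag]
    refine ⟨?_, fun i _ => mem_univ i⟩
    have := hp (mem_support_iff.1 hα)
    rw [Finsupp.weight_apply, Finsupp.sum_fintype _ _ (by simp)] at this
    simpa using this

lemma norm_eval_le {p : MvPolynomial σ ℂ} {l : ℕ} (hp : p.IsHomogeneous l)
    (x : EuclideanSpace ℂ σ) : ‖eval x p‖ ≤ polyNorm p * ‖x‖ ^ l := by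
  have h1 : ‖eval x p‖ ≤ ∑ α ∈ p.support, (‖p.coeff α‖ / √(Finsupp.multinomial α : ℝ)) *
      (√(Finsupp.multinomial α : ℝ) * ∏ i, ‖x i‖ ^ α i) := by
    rw [eval_eq']
    refine (norm_sum_le _ _).trans (sum_le_sum fun α _ => le_of_eq ?_)
    have : (0 : ℝ) < Finsupp.multinomial α := by exact_mod_cast multinomial_pos α
    rw [norm_mul, norm_prod]
    simp only [norm_pow]
    field_simp
  refine h1.trans ((Real.sum_mul_le_sqrt_mul_sqrt _ _ _).trans ?_)
  refine mul_le_mul (le_of_eq ?_) ?_ (Real.sqrt_nonneg _) (polyNorm_nonneg p)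
  · unfold polyNorm
    congr 1
    refine sum_congr rfl fun α _ => ?_
    rw [div_pow, Real.sq_sqrt (Nat.cast_nonneg _)]
  · refine Real.sqrt_le_iff.2 ⟨by positivity, le_trans (le_of_eq ?_) (sum_multinomial_mul_le hp x)⟩
    refine sum_congr rfl fun α _ => ?_
    rw [mul_pow, Real.sq_sqrt (Nat.cast_nonneg _), ← prod_pow]
    congr 1
    exact prod_congr rfl fun i _ => by ring

lemma one_add_div_pow_le_exp (c : ℝ) (hc : 0 ≤ c) {l : ℕ} (hl : 1 ≤ l) :
    (1 + c / l) ^ l ≤ Real.exp c := by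
  have hl' : (l : ℝ) ≠ 0 := by positivity
  calc (1 + c / l) ^ l ≤ Real.exp (c / l) ^ l := by
        gcongr
        linarith [Real.add_one_le_exp (c / l)]
    _ = Real.exp c := by rw [← Real.exp_nat_mul]; congr 1; field_simp

lemma norm_eval_dirDeriv_le_near {p : MvPolynomial σ ℂ} {l : ℕ} (hp : p.IsHomogeneous l)
    (hl : 1 ≤ l) {x : EuclideanSpace ℂ σ} (hx : ‖x‖ ≤ 1 + 1 / l) (v : EuclideanSpace ℂ σ) :
    ‖eval x (p.dirDeriv v)‖ ≤ Real.exp 2 * l * polyNorm p * ‖v‖ := by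
  have hl' : (0 : ℝ) < l := by exact_mod_cast hl
  refine (norm_eval_dirDeriv_le p (r := 1 / l) (M := polyNorm p * Real.exp 2) (by positivity)
    (fun z hz => (norm_eval_le hp z).trans ?_) hx v).trans (le_of_eq ?_)
  · refine mul_le_mul_of_nonneg_left ?_ (polyNorm_nonneg p)
    refine le_trans ?_ (one_add_div_pow_le_exp 2 zero_le_two hl)
    gcongr
    refine hz.trans (le_of_eq (by ring))
  · field_simp

/-- On the unit ball the derivative of a homogeneous polynomial of degree `l` has norm
at most `e² l` times the Bombieri–Weyl norm. -/
lemma norm_eval_dirDeriv_le_polyNorm {p : MvPolynomial σ ℂ} {l : ℕ} (hp : p.IsHomogeneous l)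
    (hl : 1 ≤ l) {x : EuclideanSpace ℂ σ} (hx : ‖x‖ ≤ 1) (v : EuclideanSpace ℂ σ) :
    ‖eval x (p.dirDeriv v)‖ ≤ Real.exp 2 * l * polyNorm p * ‖v‖ :=
  norm_eval_dirDeriv_le_near hp hl (hx.trans (by simp)) v

/-- On the unit ball the derivative of a homogeneous polynomial of degree `l` is Lipschitz with
constant `e² l²` times the Bombieri–Weyl norm. -/
lemma norm_eval_dirDeriv_sub_le {p : MvPolynomial σ ℂ} {l : ℕ} (hp : p.IsHomogeneous l)
    (hl : 1 ≤ l) {x y : EuclideanSpace ℂ σ} (hx : ‖x‖ ≤ 1) (hy : ‖y‖ ≤ 1)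
    (v : EuclideanSpace ℂ σ) :
    ‖eval y (p.dirDeriv v) - eval x (p.dirDeriv v)‖ ≤
      Real.exp 2 * l ^ 2 * polyNorm p * ‖v‖ * ‖y - x‖ := by
  have hl' : (0 : ℝ) < l := by exact_mod_cast hl
  refine norm_eval_sub_eval_le _ (fun z hz u => ?_) hx hy
  refine (norm_eval_dirDeriv_le _ (r := 1 / l) (by positivity)
    (fun w hw => norm_eval_dirDeriv_le_near hp hl hw v) hz u).trans (le_of_eq ?_)
  field_simp

end Polynomial

section System

variable {n : ℕ} {d : Fin n → ℕ}

lemma weylNorm_nonneg (g : PolySystem n d) : 0 ≤ weylNorm g := Real.sqrt_nonneg _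

lemma weylNorm_eq (g : PolySystem n d) :
    weylNorm g = √(∑ i, polyNorm (g i : MvPolynomial (Fin (n + 1)) ℂ) ^ 2) := by
  unfold weylNorm polyNorm
  congr 1
  refine Finset.sum_congr rfl fun i _ => ?_
  rw [Real.sq_sqrt (by positivity)]

lemma polyNorm_le_weylNorm (g : PolySystem n d) (i : Fin n) :
    polyNorm (g i : MvPolynomial (Fin (n + 1)) ℂ) ≤ weylNorm g := by
  rw [weylNorm_eq]
  refine Real.le_sqrt_of_sq_le ?_
  exact Finset.single_le_sum (f := fun i => polyNorm (g i : MvPolynomial (Fin (n + 1)) ℂ) ^ 2)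
    (fun j _ => sq_nonneg _) (Finset.mem_univ i)

lemma weylNorm_pos {g : PolySystem n d} (hg : g ≠ 0) : 0 < weylNorm g := by
  refine (weylNorm_nonneg g).lt_of_ne' fun h => hg (funext fun i => Subtype.ext ?_)
  refine MvPolynomial.funext fun x => ?_
  have h1 := norm_eval_le ((MvPolynomial.mem_homogeneousSubmodule _ _).1 (g i).2)
    (WithLp.toLp 2 x)
  have h2 : polyNorm (g i : MvPolynomial (Fin (n + 1)) ℂ) = 0 :=
    le_antisymm (h ▸ polyNorm_le_weylNorm g i) (polyNorm_nonneg _)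
  rw [h2, zero_mul] at h1
  simpa using norm_le_zero_iff.1 h1

lemma norm_le_mul_weylNorm (g : PolySystem n d) {K : ℝ} (hK : 0 ≤ K)
    (u : EuclideanSpace ℂ (Fin n))
    (hu : ∀ i, ‖u i‖ ≤ K * polyNorm (g i : MvPolynomial (Fin (n + 1)) ℂ)) :
    ‖u‖ ≤ K * weylNorm g := by
  rw [weylNorm_eq, EuclideanSpace.norm_eq]
  refine Real.sqrt_le_iff.2 ⟨by positivity, ?_⟩
  rw [mul_pow, Real.sq_sqrt (by positivity), Finset.mul_sum]
  refine Finset.sum_le_sum fun i _ => ?_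
  rw [← mul_pow]
  exact pow_le_pow_left₀ (norm_nonneg _) (hu i) 2

lemma differential_apply (g : PolySystem n d) (x v : EuclideanSpace ℂ (Fin (n + 1)))
    (i : Fin n) :
    differential g x v i =
      MvPolynomial.eval x ((g i : MvPolynomial (Fin (n + 1)) ℂ).dirDeriv v) := by
  simp [differential, jacobian, Matrix.mulVec, dotProduct, MvPolynomial.dirDeriv, mul_comm]

/-- The differential with its `i`-th row divided by `√(d i)`. -/
noncomputable def scaledDifferential (g : PolySystem n d)
    (x : EuclideanSpace ℂ (Fin (n + 1))) :
    EuclideanSpace ℂ (Fin (n + 1)) →L[ℂ] EuclideanSpace ℂ (Fin n) :=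
  (diagOp fun i => ((√(d i : ℝ))⁻¹ : ℂ)).comp (differential g x)

lemma scaledDifferential_apply (g : PolySystem n d)
    (x v : EuclideanSpace ℂ (Fin (n + 1))) (i : Fin n) :
    scaledDifferential g x v i = (√(d i : ℝ) : ℂ)⁻¹ *
      MvPolynomial.eval x ((g i : MvPolynomial (Fin (n + 1)) ℂ).dirDeriv v) := by
  simp [scaledDifferential, diagOp_apply, differential_apply]

lemma le_maxDegree (d : Fin n → ℕ) (i : Fin n) : d i ≤ maxDegree d :=
  Finset.le_sup (f := d) (Finset.mem_univ i)

lemma norm_scaledDifferential_le (hd : ∀ i, 1 ≤ d i) (g : PolySystem n d)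
    {x : EuclideanSpace ℂ (Fin (n + 1))} (hx : ‖x‖ ≤ 1) (v : EuclideanSpace ℂ (Fin (n + 1))) :
    ‖scaledDifferential g x v‖ ≤
      Real.exp 2 * √(maxDegree d : ℝ) * ‖v‖ * weylNorm g := by
  refine norm_le_mul_weylNorm g (by positivity) _ fun i => ?_
  have hdi : (0 : ℝ) < d i := by exact_mod_cast hd i
  have hD : (d i : ℝ) ≤ maxDegree d := by exact_mod_cast le_maxDegree d i
  have hp := norm_eval_dirDeriv_le_polyNorm
    ((MvPolynomial.mem_homogeneousSubmodule _ _).1 (g i).2) (hd i) hx v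
  have hP := polyNorm_nonneg (g i : MvPolynomial (Fin (n + 1)) ℂ)
  rw [scaledDifferential_apply, norm_mul, norm_inv, Complex.norm_of_nonneg (by positivity)]
  calc (√(d i : ℝ))⁻¹ * _ ≤ (√(d i : ℝ))⁻¹ *
        (Real.exp 2 * d i * polyNorm (g i : MvPolynomial (Fin (n + 1)) ℂ) * ‖v‖) := by gcongr
    _ = Real.exp 2 * √(d i : ℝ) * ‖v‖ * polyNorm (g i : MvPolynomial (Fin (n + 1)) ℂ) := by
        have h := Real.mul_self_sqrt hdi.le
        have h' : √(d i : ℝ) ≠ 0 := (Real.sqrt_pos.2 hdi).ne'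
        field_simp
        rw [sq, h]
    _ ≤ _ := by gcongr

lemma norm_scaledDifferential_sub_le (hd : ∀ i, 1 ≤ d i) (g : PolySystem n d)
    {x y : EuclideanSpace ℂ (Fin (n + 1))} (hx : ‖x‖ ≤ 1) (hy : ‖y‖ ≤ 1)
    (v : EuclideanSpace ℂ (Fin (n + 1))) :
    ‖scaledDifferential g y v - scaledDifferential g x v‖ ≤
      Real.exp 2 * (maxDegree d * √(maxDegree d : ℝ)) * ‖v‖ * ‖y - x‖ * weylNorm g := by
  refine norm_le_mul_weylNorm g (by positivity) _ fun i => ?_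
  have hdi : (0 : ℝ) < d i := by exact_mod_cast hd i
  have hD : (d i : ℝ) ≤ maxDegree d := by exact_mod_cast le_maxDegree d i
  have hp := norm_eval_dirDeriv_sub_le
    ((MvPolynomial.mem_homogeneousSubmodule _ _).1 (g i).2) (hd i) hx hy v
  have hP := polyNorm_nonneg (g i : MvPolynomial (Fin (n + 1)) ℂ)
  rw [PiLp.sub_apply, scaledDifferential_apply, scaledDifferential_apply, ← mul_sub,
    norm_mul, norm_inv, Complex.norm_of_nonneg (by positivity)]
  calc (√(d i : ℝ))⁻¹ * _ ≤ (√(d i : ℝ))⁻¹ * (Real.exp 2 * d i ^ 2 *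
        polyNorm (g i : MvPolynomial (Fin (n + 1)) ℂ) * ‖v‖ * ‖y - x‖) := by gcongr
    _ = Real.exp 2 * (d i * √(d i : ℝ)) * ‖v‖ * ‖y - x‖ *
        polyNorm (g i : MvPolynomial (Fin (n + 1)) ℂ) := by
        have h := Real.mul_self_sqrt hdi.le
        have h' : √(d i : ℝ) ≠ 0 := (Real.sqrt_pos.2 hdi).ne'
        field_simp
        rw [sq (√(d i : ℝ)), h]
    _ ≤ _ := by gcongr

lemma diagOp_sqrt_comp_scaledDifferential (hd : ∀ i, 1 ≤ d i) (g : PolySystem n d)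
    (x : EuclideanSpace ℂ (Fin (n + 1))) :
    (diagOp fun i => (√(d i : ℝ) : ℂ)).comp (scaledDifferential g x) = differential g x := by
  rw [scaledDifferential, ← ContinuousLinearMap.comp_assoc, diagOp_comp]
  have h : (fun i => (√(d i : ℝ) : ℂ) * (√(d i : ℝ) : ℂ)⁻¹) = fun _ => 1 := by
    funext i
    have hdi : (0 : ℝ) < d i := by exact_mod_cast hd i
    exact mul_inv_cancel₀ (by exact_mod_cast (Real.sqrt_pos.2 hdi).ne')
  rw [h, diagOp_one, ContinuousLinearMap.id_comp]

lemma scaledDifferential_eq_of_differential_eq (hd : ∀ i, 1 ≤ d i) (g : PolySystem n d)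
    (x v : EuclideanSpace ℂ (Fin (n + 1))) (w : EuclideanSpace ℂ (Fin n))
    (h : differential g x v = diagOp (fun i => (√(d i : ℝ) : ℂ)) w) :
    scaledDifferential g x v = w := by
  rw [scaledDifferential, ContinuousLinearMap.comp_apply, h, ← ContinuousLinearMap.comp_apply,
    diagOp_comp]
  have h : (fun i => (√(d i : ℝ) : ℂ)⁻¹ * (√(d i : ℝ) : ℂ)) = fun _ => 1 := by
    funext i
    have hdi : (0 : ℝ) < d i := by exact_mod_cast hd i
    exact inv_mul_cancel₀ (by exact_mod_cast (Real.sqrt_pos.2 hdi).ne')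
  rw [h, diagOp_one]
  rfl

/-- A finite condition number bounds the scaled differential from below. -/
lemma exists_mu_eq_ofReal (hd : ∀ i, 1 ≤ d i) (g : PolySystem n d)
    {x : EuclideanSpace ℂ (Fin (n + 1))} (hx : ‖x‖ = 1) (h : mu g x ≠ ⊤) :
    ∃ m : ℝ, 0 ≤ m ∧ mu g x = ENNReal.ofReal m ∧
      ∀ v ∈ (ℂ ∙ x)ᗮ, weylNorm g * ‖v‖ ≤ m * ‖scaledDifferential g x v‖ := by
  unfold mu muOn at h ⊢
  split_ifs at h ⊢ with hA
  · refine ⟨weylNorm g * ‖((differential g x).comp ((ℂ ∙ x)ᗮ).subtypeL).inverse.comp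
      (diagOp fun i => ((√(d i : ℝ) * ‖x‖ ^ (d i - 1) : ℝ) : ℂ))‖,
      mul_nonneg (weylNorm_nonneg g) (ContinuousLinearMap.opNorm_nonneg _), rfl, fun v hv => ?_⟩
    rw [mul_assoc]
    refine mul_le_mul_of_nonneg_left ?_ (weylNorm_nonneg g)
    simp only [hx, one_pow, mul_one]
    set A := (differential g x).comp ((ℂ ∙ x)ᗮ).subtypeL with hAdef
    have h1 : A.inverse (A ⟨v, hv⟩) = ⟨v, hv⟩ := by
      have := hA.inverse_comp_self
      exact DFunLike.congr_fun this (⟨v, hv⟩ : (ℂ ∙ x)ᗮ)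
    have h2 : A ⟨v, hv⟩ = (diagOp fun i => (√(d i : ℝ) : ℂ)) (scaledDifferential g x v) := by
      rw [← ContinuousLinearMap.comp_apply, diagOp_sqrt_comp_scaledDifferential hd]
      rfl
    have h3 := (A.inverse.comp (diagOp fun i => (√(d i : ℝ) : ℂ))).le_opNorm
      (scaledDifferential g x v)
    rw [ContinuousLinearMap.comp_apply, ← h2, h1] at h3
    exact h3
  · exact absurd rfl h

lemma finrank_orthogonal_singleton {x : EuclideanSpace ℂ (Fin (n + 1))} (hx : x ≠ 0) :
    Module.finrank ℂ (ℂ ∙ x)ᗮ = n := by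
  have : Fact (Module.finrank ℂ (EuclideanSpace ℂ (Fin (n + 1))) = n + 1) := ⟨by simp⟩
  exact Submodule.finrank_orthogonal_span_singleton hx

/-- A lower bound on the scaled differential bounds the condition number. -/
lemma mu_le_ofReal (hd : ∀ i, 1 ≤ d i) {g : PolySystem n d} (hg : g ≠ 0)
    {y : EuclideanSpace ℂ (Fin (n + 1))} (hy : ‖y‖ = 1) {m : ℝ} (hm : 0 ≤ m)
    (h : ∀ v ∈ (ℂ ∙ y)ᗮ, weylNorm g * ‖v‖ ≤ m * ‖scaledDifferential g y v‖) :
    mu g y ≤ ENNReal.ofReal m := by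
  have hW := weylNorm_pos hg
  have hy0 : y ≠ 0 := norm_ne_zero_iff.1 (by rw [hy]; exact one_ne_zero)
  unfold mu muOn
  set A := (differential g y).comp ((ℂ ∙ y)ᗮ).subtypeL with hAdef
  have hinj : Function.Injective A.toLinearMap := by
    rw [← LinearMap.ker_eq_bot, LinearMap.ker_eq_bot']
    intro v hv
    have h1 : scaledDifferential g y v = 0 := by
      refine scaledDifferential_eq_of_differential_eq hd g y v 0 ?_
      rw [map_zero]
      exact hv
    have h2 := h v v.2
    rw [h1, norm_zero, mul_zero] at h2
    have h3 : ‖(v : EuclideanSpace ℂ (Fin (n + 1)))‖ ≤ 0 := by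
      by_contra! hlt
      exact absurd h2 (not_le.2 (mul_pos hW hlt))
    exact Subtype.ext (norm_le_zero_iff.1 h3)
  have hA : A.IsInvertible := by
    refine ⟨(A.toLinearMap.linearEquivOfInjective hinj ?_).toContinuousLinearEquiv, ?_⟩
    · rw [finrank_orthogonal_singleton hy0]
      simp
    · ext v
      rfl
  rw [if_pos hA]
  refine ENNReal.ofReal_le_ofReal ?_
  rw [mul_comm, ← le_div_iff₀ hW]
  refine ContinuousLinearMap.opNorm_le_bound _ (by positivity) fun w => ?_
  simp only [hy, one_pow, mul_one]
  set v := (A.inverse.comp (diagOp fun i => (√(d i : ℝ) : ℂ))) w with hv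
  have h1 : A v = diagOp (fun i => (√(d i : ℝ) : ℂ)) w := by
    have := hA.self_comp_inverse
    exact DFunLike.congr_fun this (diagOp (fun i => (√(d i : ℝ) : ℂ)) w)
  have h2 := h v v.2
  rw [scaledDifferential_eq_of_differential_eq hd g y v w h1] at h2
  rw [div_mul_eq_mul_div, le_div_iff₀ hW, mul_comm]
  exact h2

lemma norm_sub_le_lineAngle {x y : EuclideanSpace ℂ (Fin (n + 1))} (hx : ‖x‖ = 1)
    (hy : ‖y‖ = 1) (hxy : inner ℂ x y = (‖inner ℂ x y‖ : ℂ)) :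
    ‖x - y‖ ≤ lineAngle x y := by
  have hle : ‖inner ℂ x y‖ ≤ 1 := by simpa [hx, hy] using norm_inner_le_norm (𝕜 := ℂ) x y
  have h0 : 0 ≤ lineAngle x y := Real.arccos_nonneg _
  have hcos : Real.cos (lineAngle x y) = ‖inner ℂ x y‖ := by
    rw [lineAngle, hx, hy, mul_one, div_one,
      Real.cos_arccos (by linarith [norm_nonneg (inner ℂ x y)]) hle]
  refine abs_le_of_sq_le_sq' ?_ h0 |>.2
  have h1 := norm_sub_sq (𝕜 := ℂ) x y
  rw [hx, hy, hxy, ← hcos] at h1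
  have h2 := Real.one_sub_sq_div_two_le_cos (x := lineAngle x y)
  rw [h1]
  simp only [Complex.ofReal_re, RCLike.re_to_complex]
  linarith

/-- A line has a unit representative whose inner product with a given vector is real and
nonnegative. -/
lemma exists_unit_representative (x : EuclideanSpace ℂ (Fin (n + 1)))
    {y : EuclideanSpace ℂ (Fin (n + 1))} (hy : y ≠ 0) :
    ∃ a : ℂ, a ≠ 0 ∧ ‖a • y‖ = 1 ∧ inner ℂ x (a • y) = (‖inner ℂ x (a • y)‖ : ℂ) := by
  have hy' : ‖y‖ ≠ 0 := norm_ne_zero_iff.2 hy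
  rcases eq_or_ne (inner ℂ x y) 0 with h | h
  · refine ⟨(‖y‖⁻¹ : ℝ), by simpa using hy, ?_, by simp [h]⟩
    rw [norm_smul, Complex.norm_of_nonneg (by positivity), inv_mul_cancel₀ hy']
  · set z := inner ℂ x y with hz
    have hz' : ‖z‖ ≠ 0 := norm_ne_zero_iff.2 h
    have ha : ‖((‖y‖⁻¹ * ‖z‖ : ℝ) : ℂ) * z⁻¹‖ = ‖y‖⁻¹ := by
      rw [norm_mul, norm_inv, Complex.norm_of_nonneg (by positivity)]
      field_simp
    refine ⟨((‖y‖⁻¹ * ‖z‖ : ℝ) : ℂ) * z⁻¹, ?_, ?_, ?_⟩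
    · rw [← norm_ne_zero_iff, ha]
      exact inv_ne_zero hy'
    · rw [norm_smul, ha, inv_mul_cancel₀ hy']
    · rw [inner_smul_right, ← hz, norm_mul, ha, mul_assoc, inv_mul_cancel₀ h]
      push_cast
      ring

lemma mul_sqrt_le_of_lower_bound [NeZero n] (hd : ∀ i, 1 ≤ d i) {g : PolySystem n d}
    (hg : g ≠ 0) {x : EuclideanSpace ℂ (Fin (n + 1))} (hx : ‖x‖ = 1) {m : ℝ} (hm : 0 ≤ m)
    (h : ∀ v ∈ (ℂ ∙ x)ᗮ, weylNorm g * ‖v‖ ≤ m * ‖scaledDifferential g x v‖) :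
    1 ≤ m * (Real.exp 2 * √(maxDegree d : ℝ)) := by
  have hx0 : x ≠ 0 := norm_ne_zero_iff.1 (by rw [hx]; exact one_ne_zero)
  have : Nontrivial (ℂ ∙ x)ᗮ := Module.nontrivial_of_finrank_pos (R := ℂ) (by
    rw [finrank_orthogonal_singleton hx0]
    exact NeZero.pos n)
  obtain ⟨v, hv⟩ := exists_ne (0 : (ℂ ∙ x)ᗮ)
  have hv' : 0 < ‖(v : EuclideanSpace ℂ (Fin (n + 1)))‖ :=
    norm_pos_iff.2 fun h0 => hv (Subtype.ext h0)
  have h1 := (h v v.2).trans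
    (mul_le_mul_of_nonneg_left (norm_scaledDifferential_le hd g hx.le v) hm)
  refine le_of_mul_le_mul_right ?_ (mul_pos (weylNorm_pos hg) hv')
  linarith

/-- The quantitative stability of the condition number on unit representatives. -/
lemma lower_bound_of_norm_sub_le [NeZero n] (hd : ∀ i, 1 ≤ d i) {g : PolySystem n d}
    (hg : g ≠ 0) {x y : EuclideanSpace ℂ (Fin (n + 1))} (hx : ‖x‖ = 1) (hy : ‖y‖ = 1)
    {m c : ℝ} (hm : 0 ≤ m)
    (h : ∀ v ∈ (ℂ ∙ x)ᗮ, weylNorm g * ‖v‖ ≤ m * ‖scaledDifferential g x v‖)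
    (hc : Real.exp 2 * (maxDegree d * √(maxDegree d : ℝ)) * m * ‖x - y‖ ≤ c) :
    ∀ v ∈ (ℂ ∙ y)ᗮ, (1 - 3 * c) * (weylNorm g * ‖v‖) ≤ m * ‖scaledDifferential g y v‖ := by
  intro v hv
  have hW := weylNorm_nonneg g
  set W := weylNorm g
  set δ := ‖x - y‖ with hδ
  set D : ℝ := (maxDegree d : ℝ) with hD
  have hD1 : 1 ≤ D := by
    have := (hd 0).trans (le_maxDegree d 0)
    rw [hD]
    exact_mod_cast this
  have h1 := mul_sqrt_le_of_lower_bound hd hg hx hm h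
  have hδ0 : 0 ≤ δ := norm_nonneg _
  have hS : Real.exp 2 * √D ≤ Real.exp 2 * (D * √D) := by
    gcongr
    exact le_mul_of_one_le_left (Real.sqrt_nonneg _) hD1
  set K := Real.exp 2 * (D * √D) with hK
  have hδc : δ ≤ c := by
    refine le_trans ?_ hc
    have : 1 ≤ K * m := h1.trans (by rw [mul_comm]; gcongr)
    exact le_mul_of_one_le_left hδ0 this
  have hin : ‖inner ℂ x v‖ ≤ δ * ‖v‖ := by
    have hyv : inner ℂ y v = 0 := Submodule.mem_orthogonal_singleton_iff_inner_right.1 hv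
    rw [show inner ℂ x v = inner ℂ (x - y) v by rw [inner_sub_left, hyv, sub_zero]]
    exact norm_inner_le_norm _ _
  set u := inner ℂ x v • x with hu
  have hu' : ‖u‖ ≤ δ * ‖v‖ := by rw [hu, norm_smul, hx, mul_one]; exact hin
  have hw : v - u ∈ (ℂ ∙ x)ᗮ := by
    rw [Submodule.mem_orthogonal_singleton_iff_inner_right, inner_sub_right, hu,
      inner_smul_right, inner_self_eq_norm_sq_to_K, hx]
    simp
  have hA := h _ hw
  have hB := norm_scaledDifferential_le hd g hx.le u
  have hC := norm_scaledDifferential_sub_le hd g hx.le hy.le v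
  rw [norm_sub_rev y x] at hC
  have htri : ‖scaledDifferential g x (v - u)‖ ≤ ‖scaledDifferential g y v‖ +
      ‖scaledDifferential g x u‖ + ‖scaledDifferential g y v - scaledDifferential g x v‖ := by
    have : scaledDifferential g x (v - u) = scaledDifferential g y v -
        scaledDifferential g x u - (scaledDifferential g y v - scaledDifferential g x v) := by
      rw [map_sub]
      abel
    rw [this]
    refine (norm_sub_le _ _).trans ?_
    gcongr
    exact norm_sub_le _ _
  have hvu : (1 - δ) * ‖v‖ ≤ ‖v - u‖ := by
    have := norm_sub_norm_le v u
    linarith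
  have hB' : ‖scaledDifferential g x u‖ ≤ K * δ * (W * ‖v‖) := by
    refine hB.trans ?_
    calc Real.exp 2 * √D * ‖u‖ * W ≤ K * (δ * ‖v‖) * W := by gcongr
      _ = _ := by ring
  have hC' : ‖scaledDifferential g y v - scaledDifferential g x v‖ ≤ K * δ * (W * ‖v‖) :=
    hC.trans (le_of_eq (by ring))
  have hWv : 0 ≤ W * ‖v‖ := by positivity
  have e1 : (1 - δ) * (W * ‖v‖) ≤ W * ‖v - u‖ :=
    le_trans (le_of_eq (by ring)) (mul_le_mul_of_nonneg_left hvu hW)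
  have e2 : m * ‖scaledDifferential g x (v - u)‖ ≤
      m * (‖scaledDifferential g y v‖ + K * δ * (W * ‖v‖) + K * δ * (W * ‖v‖)) := by
    gcongr
    exact htri.trans (by gcongr)
  have e3 : K * m * δ * (W * ‖v‖) ≤ c * (W * ‖v‖) := by gcongr
  have e4 : δ * (W * ‖v‖) ≤ c * (W * ‖v‖) := by gcongr
  linarith

end System

end CondNumber

theorem theorem1 (ε : ℝ) (hε : 0 < ε) :
    ∃ C : ℝ, 0 < C ∧
      ∀ (n : ℕ) (d : Fin n → ℕ), (∀ i, 1 ≤ d i) →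
        ∀ (g : Projectivization ℂ (CondNumber.PolySystem n d))
          (ζ η : Projectivization ℂ (EuclideanSpace ℂ (Fin (n + 1)))),
          ENNReal.ofReal (CondNumber.angleDist ζ η) <
              ENNReal.ofReal C /
                ((CondNumber.maxDegree d : ENNReal) ^ (3 / 2 : ℝ) * CondNumber.muNorm g ζ) →
            CondNumber.muNorm g η ≤ ENNReal.ofReal (1 + ε) * CondNumber.muNorm g ζ := by
  refine ⟨ε / (1 + ε) / 3 / Real.exp 2, by positivity, fun n d hd g ζ η h => ?_⟩
  induction g using Projectivization.ind with | h g hg => ?_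
  induction ζ using Projectivization.ind with | h x hx => ?_
  induction η using Projectivization.ind with | h y hy => ?_
  change ENNReal.ofReal (CondNumber.lineAngle x y) < _ / (_ * CondNumber.mu g x) at h
  change CondNumber.mu g y ≤ _ * CondNumber.mu g x
  have hn : NeZero n := ⟨by
    rintro rfl
    exact hg (funext fun i => i.elim0)⟩
  obtain ⟨a, ha, hax, -⟩ := CondNumber.exists_unit_representative x hx
  obtain ⟨b, hb, hby, hab⟩ := CondNumber.exists_unit_representative (a • x) hy
  rw [← CondNumber.lineAngle_smul a b ha hb] at h
  rw [← CondNumber.mu_smul 1 a one_ne_zero ha g x, one_smul] at h ⊢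
  rw [← CondNumber.mu_smul 1 b one_ne_zero hb g y, one_smul]
  generalize a • x = x at *
  generalize b • y = y at *
  have hD1 : 1 ≤ CondNumber.maxDegree d := (hd 0).trans (CondNumber.le_maxDegree d 0)
  have hD0 : (0 : ℝ) < CondNumber.maxDegree d := by exact_mod_cast hD1
  have htop : CondNumber.mu g x ≠ ⊤ := by
    intro htop
    rw [htop, ENNReal.mul_top, ENNReal.div_top] at h
    · exact not_lt_zero h
    · have : (CondNumber.maxDegree d : ENNReal) ≠ 0 := by exact_mod_cast (by omega)
      simp [this]
  obtain ⟨m, hm, hmu, hlow⟩ := CondNumber.exists_mu_eq_ofReal hd g hax htop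
  have hm0 : 0 < m := by
    refine hm.lt_of_ne' fun h0 => ?_
    have := CondNumber.mul_sqrt_le_of_lower_bound hd hg hax hm hlow
    rw [h0, zero_mul] at this
    linarith
  have hpow : (CondNumber.maxDegree d : ENNReal) ^ (3 / 2 : ℝ) =
      ENNReal.ofReal (CondNumber.maxDegree d * √(CondNumber.maxDegree d : ℝ)) := by
    rw [← ENNReal.ofReal_natCast, ENNReal.ofReal_rpow_of_pos hD0, Real.sqrt_eq_rpow]
    congr 1
    nth_rewrite 2 [← Real.rpow_one (CondNumber.maxDegree d : ℝ)]
    rw [← Real.rpow_add hD0]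
    norm_num
  rw [hmu, hpow, ← ENNReal.ofReal_mul (by positivity),
    ← ENNReal.ofReal_div_of_pos (by positivity),
    ENNReal.ofReal_lt_ofReal_iff (by positivity), lt_div_iff₀ (by positivity)] at h
  have hdist := CondNumber.norm_sub_le_lineAngle hax hby hab
  have hc : Real.exp 2 * (CondNumber.maxDegree d * √(CondNumber.maxDegree d : ℝ)) * m *
      ‖x - y‖ ≤ ε / (1 + ε) / 3 := by
    rw [lt_div_iff₀ (by positivity)] at h
    refine le_trans ?_ h.le
    calc _ ≤ Real.exp 2 * (CondNumber.maxDegree d * √(CondNumber.maxDegree d : ℝ)) * m *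
        CondNumber.lineAngle x y := by gcongr
      _ = _ := by ring
  have hlow' := CondNumber.lower_bound_of_norm_sub_le hd hg hax hby hm hlow hc
  rw [hmu, ← ENNReal.ofReal_mul (by positivity)]
  refine CondNumber.mu_le_ofReal hd hg hby (by positivity) fun v hv => ?_
  have h3 : 1 - 3 * (ε / (1 + ε) / 3) = (1 + ε)⁻¹ := by
    field_simp
    ring
  have h4 := hlow' v hv
  rw [h3, inv_mul_le_iff₀ (by positivity)] at h4
  linarith
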